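/- Theorem 2.1. Let $E$ be a real Fréchet space whose topology is defined by seminorms $\{\|\cdot\|_n\}_{n\in\mathbb N}$, and let $\{e_k\}_{k\in\mathbb N}$ be an unconditional Schauder basis of $E$: every $x\in E$ has a unique expansion $x=\sum_{k=1}^\infty x_ke_k$ with real $x_k$, convergent in $E$, and for every permutation $\pi$ of $\mathbb N$ the series $\sum_{k=1}^\infty x_{\pi(k)}e_{\pi(k)}$ converges. Write $x\ll y$ iff $|x_k|\le y_k$ for all $k$, and for $y\in E$ let $\mathcal X_k[y]x=\sum_{j\ne k}x_je_j+y_ke_k$. Let $0<T<\infty$, $I_T=[0,T]$, and let $X(t)=\sum_{k=1}^\infty X_k(t)e_k\in C(I_T,E)$ with $X_k\in C^1(I_T)$ and $X_k(t)>0$ for all $k\in\mathbb N$, $t\in I_T$. Put $W_X=\{(t,x)\in I_T\times E\mid x\ll X(t)\}$ and let $f=\sum_{k=1}^\infty f_ke_k: W_X\to E$ be continuous. Suppose that for each $(t,x)\in W_X$ and each $k$ both inequalities $$f_k\bigl(t,\mathcal X_k[X(t)]x\bigr)\le\dot X_k(t),\qquad -f_k\bigl(t,\mathcal X_k[-X(t)]x\bigr)\le\dot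 X_k(t)$$ hold, and let $\hat x\in E$ satisfy $\hat x\ll X(0)$. Then the problem $\dot x=f(t,x)$, $x(0)=\hat x$ has a solution $x\in C^1(I_T,E)$ with $x(t)\ll X(t)$ for all $t\in I_T$. Here $x\in C^1(I_T,E)$ means that for each $t\in I_T$ there is $\dot x(t)\in E$ with $\bigl\|\tfrac{x(t+h)-x(t)}h-\dot x(t)\bigr\|_i\to0$ as $h\to0$ for every $i$ (one-sided at the endpoints of $I_T$), and $\dot x\in C(I_T,E)$. -/

import Mathlib

open Set Filter Topology

noncomputable section

namespace FrechetODE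

section Basis

variable {E : Type*} [AddCommGroup E] [Module ℝ E] [TopologicalSpace E]

/-- The series `∑ aₖ eₖ` converges to `x`, as the limit of its consecutive partial sums
(indices start at `0`). -/
def SeriesConverges (e : ℕ → E) (a : ℕ → ℝ) (x : E) : Prop :=
  Tendsto (fun n : ℕ => ∑ k ∈ Finset.range n, a k • e k) atTop (𝓝 x)

/-- `e` is a Schauder basis: every vector has a unique expansion along `e`. -/
def IsSchauderBasis (e : ℕ → E) : Prop :=
  ∀ x : E, ∃! a : ℕ → ℝ, SeriesConverges e a x

/-- The `k`-th coordinate of `x` in the Schauder basis `e`. -/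
def coord {e : ℕ → E} (he : IsSchauderBasis e) (x : E) (k : ℕ) : ℝ :=
  (he x).choose k

theorem coord_spec {e : ℕ → E} (he : IsSchauderBasis e) (x : E) :
    SeriesConverges e (coord he x) x :=
  (he x).choose_spec.1

theorem coord_unique {e : ℕ → E} (he : IsSchauderBasis e) {x : E} {a : ℕ → ℝ}
    (h : SeriesConverges e a x) : a = coord he x :=
  (he x).choose_spec.2 a h

/-- The Schauder basis `e` is unconditional: every rearrangement of the expansion of every
vector converges. -/
def IsUnconditional {e : ℕ → E} (he : IsSchauderBasis e) : Prop :=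
  ∀ (x : E) (π : Equiv.Perm ℕ), ∃ y : E,
    SeriesConverges (fun k => e (π k)) (fun k => coord he x (π k)) y

/-- `x ≪ y`: the vector `y` is a majorant for `x`. -/
def Majorized {e : ℕ → E} (he : IsSchauderBasis e) (x y : E) : Prop :=
  ∀ k, |coord he x k| ≤ coord he y k

/-- The affine map `x ↦ 𝒳ₖ[y] x`: the `k`-th coordinate of `x` is replaced by that of `y`. -/
def replaceCoord {e : ℕ → E} (he : IsSchauderBasis e) (k : ℕ) (y x : E) : E :=
  x - coord he x k • e k + coord he y k • e k

theorem coord_replaceCoord [IsTopologicalAddGroup E] {e : ℕ → E} (he : IsSchauderBasis e)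
    (k : ℕ) (y x : E) :
    coord he (replaceCoord he k y x) = Function.update (coord he x) k (coord he y k) := by
  refine (coord_unique he ?_).symm
  have h := ((coord_spec he x).sub_const (coord he x k • e k)).add_const (coord he y k • e k)
  refine h.congr' ?_
  filter_upwards [eventually_gt_atTop k] with n hn
  have hk : k ∈ Finset.range n := Finset.mem_range.2 hn
  rw [← Finset.add_sum_erase _ _ hk, ← Finset.add_sum_erase _ _ hk]
  have hs : ∑ j ∈ (Finset.range n).erase k,
        Function.update (coord he x) k (coord he y k) j • e j
      = ∑ j ∈ (Finset.range n).erase k, coord he x j • e j :=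
    Finset.sum_congr rfl fun j hj => by
      rw [Function.update_of_ne (Finset.ne_of_mem_erase hj)]
  rw [hs, Function.update_self]
  abel

/-- The set `W_X = {(t, x) ∈ [0, T] × E | x ≪ X(t)}`. -/
def majorantSet {e : ℕ → E} (he : IsSchauderBasis e) (T : ℝ) (X : ℝ → E) : Set (ℝ × E) :=
  {z | z.1 ∈ Icc 0 T ∧ Majorized he z.2 (X z.1)}

end Basis

section Derivative

variable {E : Type*} [AddCommGroup E] [Module ℝ E]

/-- `v` is the derivative at `t` of the curve `x` on `[0, T]`: each seminorm of
`(x(t + h) - x(t)) / h - v` tends to `0` as `h → 0` with `h ≠ 0` and `t + h ∈ [0, T]`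
(so the derivative is one-sided at the two endpoints). -/
def HasDerivOnInterval (p : ℕ → Seminorm ℝ E) (T : ℝ) (x : ℝ → E) (v : E) (t : ℝ) : Prop :=
  ∀ i : ℕ, Tendsto (fun h : ℝ => p i (h⁻¹ • (x (t + h) - x t) - v))
    (𝓝[{h : ℝ | h ≠ 0 ∧ t + h ∈ Icc 0 T}] 0) (𝓝 0)

/-- `x ∈ C¹([0, T], E)`. -/
def IsC1OnInterval [TopologicalSpace E] (p : ℕ → Seminorm ℝ E) (T : ℝ) (x : ℝ → E) : Prop :=
  ∃ v : ℝ → E, (∀ t ∈ Icc 0 T, HasDerivOnInterval p T x (v t) t) ∧ ContinuousOn v (Icc 0 T)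

end Derivative

end FrechetODE

end

open FrechetODE

/-! The problem is solved in the coordinate space `ℕ → ℝ` and then carried back to `E`. Truncating
the `k`-th coordinate to `[-X_k(t), X_k(t)]` gives a right-hand side that is continuous for the
product topology and bounded in each coordinate, so a Peano theorem applies
(`exists_solution_of_bounded_continuous`). Where a coordinate reaches or passes `±X_k`, truncation
puts the state on that face, and there the hypothesis on `f` bounds the outward velocity by that of
`X_k`. Scalar comparison (`le_of_hasDerivWithinAt_le_of_ge`) then shows that the solution never
leaves the order interval, so the truncation changes nothing along it.

The return to `E` rests on unconditionality. Convergence of all rearrangements bounds the finite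
sections of every expansion, so their supremum is a seminorm, `sectionSeminorm`; an argument of
open-mapping type shows that it is continuous (`continuous_sectionSeminorm`). Up to a factor 2 it
controls every sum with dominated coefficients. Hence on order intervals coordinatewise convergence
is convergence in `E` (`tendsto_of_majorized`), and dominated coefficient sequences come from
vectors (`exists_coord_eq_of_abs_le`). It also bounds difference quotients uniformly over partial
sums, which turns coordinatewise derivatives into a derivative in `E`
(`hasDerivOnInterval_of_coord`). -/

namespace FrechetODE

/-! ### Rearrangements and unordered Cauchy sums -/

section Rearrangement

/-- Sorting by the key `g`: enumerate the infinite set `range g` increasingly and pull back along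
`g`. -/
theorem exists_perm_strictMono_comp {g : ℕ → ℕ} (hg : Function.Injective g) :
    ∃ π : Equiv.Perm ℕ, StrictMono fun n => g (π n) := by
  classical
  have : Infinite (range g) := infinite_coe_iff.2 (infinite_range_of_injective hg)
  let o : ℕ ≃o range g := Nat.Subtype.orderIsoOfNat (range g)
  refine ⟨o.toEquiv.trans (Equiv.ofInjective g hg).symm, fun a b hab => ?_⟩
  have key : ∀ n, g ((o.toEquiv.trans (Equiv.ofInjective g hg).symm) n) = o n := fun n =>
    congrArg Subtype.val ((Equiv.ofInjective g hg).apply_symm_apply (o n))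
  simp only [key]
  exact o.strictMono hab

/-- Since `g ∘ π` increases, the indices with key below `m` form an initial segment of the
enumeration `π`; `hR` makes it reach past `R`. -/
theorem exists_partialSum_eq {E : Type*} [AddCommMonoid E] {g : ℕ → ℕ} {π : Equiv.Perm ℕ}
    (hπ : StrictMono fun n => g (π n)) (u : ℕ → E) {R m : ℕ} (hR : g (π R) < m)
    {A : Finset ℕ} (hA : ∀ k, k ∈ A ↔ g k < m) :
    ∃ r, R ≤ r ∧ ∑ j ∈ Finset.range r, u (π j) = ∑ k ∈ A, u k := by
  classical
  have hex : ∃ j, m ≤ g (π j) := ⟨m, hπ.id_le m⟩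
  have hr : ∀ j, j < Nat.find hex ↔ g (π j) < m := fun j => by
    refine ⟨fun h => not_le.1 (Nat.find_min hex h), fun h => ?_⟩
    by_contra hcon
    exact absurd ((Nat.find_spec hex).trans (hπ.monotone (not_lt.1 hcon))) (not_le.2 h)
  refine ⟨Nat.find hex, ((hr R).2 hR).le, Finset.sum_equiv π (fun j => ?_) fun _ _ => rfl⟩
  rw [Finset.mem_range, hA, hr]

/-- If every rearrangement of a series converges, the series is unordered Cauchy. -/
theorem exists_tail_lt_of_forall_perm {E : Type*} [AddCommGroup E] [Module ℝ E]
    [TopologicalSpace E] [IsTopologicalAddGroup E] {p : Seminorm ℝ E} (hp : Continuous p)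
    (u : ℕ → E)
    (hu : ∀ π : Equiv.Perm ℕ, ∃ y, Tendsto (fun n => ∑ k ∈ Finset.range n, u (π k)) atTop (𝓝 y))
    {ε : ℝ} (hε : 0 < ε) :
    ∃ N : ℕ, ∀ F : Finset ℕ, (∀ k ∈ F, N ≤ k) → p (∑ k ∈ F, u k) < ε := by
  classical
  by_contra! hcon
  choose F hF hFε using hcon
  -- The blocks `[N n, N (n + 1))` partition `ℕ`, each containing the bad set `F (N n)`; `l k` below
  -- is the block of `k`.
  let N : ℕ → ℕ := fun n => Nat.rec 0 (fun _ m => m + (F m).sup id + 1) n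
  have hN : ∀ n, N (n + 1) = N n + (F (N n)).sup id + 1 := fun _ => rfl
  have hNmono : StrictMono N := strictMono_nat_of_lt_succ fun n => by rw [hN]; omega
  have hN0 : N 0 = 0 := rfl
  have hFlt : ∀ n, ∀ k ∈ F (N n), k < N (n + 1) := fun n k hk => by
    have : k ≤ (F (N n)).sup id := Finset.le_sup (f := id) hk
    rw [hN]; omega
  have hex : ∀ k, ∃ n, k < N (n + 1) := fun k =>
    ⟨k, (hNmono.id_le k).trans_lt (hNmono k.lt_succ_self)⟩
  let l : ℕ → ℕ := fun k => Nat.find (hex k)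
  have hl1 : ∀ k, k < N (l k + 1) := fun k => Nat.find_spec (hex k)
  have hl0 : ∀ k, N (l k) ≤ k := fun k => by
    rcases h : l k with _ | n
    · simp [hN0]
    · have : n < Nat.find (hex k) := by change n < l k; omega
      simpa using Nat.find_min (hex k) this
  have hl : ∀ k n, N n ≤ k → k < N (n + 1) → l k = n := fun k n h1 h2 => by
    have a := (hNmono.lt_iff_lt (a := l k) (b := n + 1)).1 ((hl0 k).trans_lt h2)
    have b := (hNmono.lt_iff_lt (a := n) (b := l k + 1)).1 (h1.trans_lt (hl1 k))
    omega
  -- Sorting by `g` keeps the blocks in order but lists the bad set first in each: its keys lie in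
  -- `[2 N n, N n + N (n + 1))`, the others in `[N n + N (n + 1), 2 N (n + 1))`.
  let g : ℕ → ℕ := fun k => k + if k ∈ F (N (l k)) then N (l k) else N (l k + 1)
  have gpos : ∀ k, k ∈ F (N (l k)) → g k = k + N (l k) := fun k h => by simp [g, h]
  have gneg : ∀ k, k ∉ F (N (l k)) → g k = k + N (l k + 1) := fun k h => by simp [g, h]
  have hlm : ∀ k, N (l k) < N (l k + 1) := fun k => hNmono (Nat.lt_succ_self _)
  have glow : ∀ k, 2 * N (l k) ≤ g k := fun k => by
    have := hl0 k; have := hlm k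
    by_cases h : k ∈ F (N (l k))
    · rw [gpos k h]; omega
    · rw [gneg k h]; omega
  have gup : ∀ k, g k < 2 * N (l k + 1) := fun k => by
    have := hl1 k; have := hlm k
    by_cases h : k ∈ F (N (l k))
    · rw [gpos k h]; omega
    · rw [gneg k h]; omega
  have glt : ∀ a b, l a < l b → g a < g b := fun a b hab => by
    have : N (l a + 1) ≤ N (l b) := hNmono.monotone hab
    have := gup a; have := glow b; omega
  have ginj : Function.Injective g := fun a b hab => by
    rcases lt_trichotomy (l a) (l b) with h | h | h
    · exact absurd hab (glt a b h).ne
    · have := hl0 a; have := hl1 a; have := hl0 b; have := hl1 b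
      have ha := gpos a; have ha' := gneg a; have hb := gpos b; have hb' := gneg b
      rw [h] at *
      by_cases h1 : a ∈ F (N (l b)) <;> by_cases h2 : b ∈ F (N (l b)) <;>
        simp only [h1, h2, not_true_eq_false, not_false_eq_true, forall_const] at ha hb ha' hb' <;>
        omega
    · exact absurd hab (glt b a h).ne'
  obtain ⟨π, hπ⟩ := exists_perm_strictMono_comp ginj
  obtain ⟨y, hy⟩ := hu π
  have hlim : Tendsto (fun n => p (∑ k ∈ Finset.range n, u (π k) - y)) atTop (𝓝 0) := by
    simpa [Function.comp_def] using (hp.tendsto _).comp (hy.sub_const y)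
  obtain ⟨R, hR⟩ := eventually_atTop.1 (hlim.eventually_lt_const (half_pos hε))
  -- A block late enough that both cuts, at keys `2 N n` and `N n + N (n + 1)`, fall beyond position
  -- `R`. The two partial sums differ by the bad sum.
  set n := g (π R) + 1 with hn
  have hnN : n ≤ N n := hNmono.id_le n
  have hnN' : N n < N (n + 1) := hNmono n.lt_succ_self
  have hlt : ∀ k, l k < n ↔ k < N n := fun k =>
    ⟨fun h => (hl1 k).trans_le (hNmono.monotone h),
      fun h => hNmono.lt_iff_lt.1 ((hl0 k).trans_lt h)⟩
  have hlow : ∀ k, k < N n → g k < 2 * N n := fun k hk =>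
    (gup k).trans_le (Nat.mul_le_mul_left 2 (hNmono.monotone ((hlt k).2 hk)))
  have hhigh : ∀ k, N n ≤ k → 2 * N n ≤ g k := fun k hk => by
    have : n ≤ l k := by have := (hlt k).not.2 (not_lt.2 hk); omega
    exact (Nat.mul_le_mul_left 2 (hNmono.monotone this)).trans (glow k)
  obtain ⟨r₁, hr₁, hs₁⟩ := exists_partialSum_eq hπ u (R := R) (m := 2 * N n)
    (A := Finset.range (N n)) (by omega) fun k => by
      rw [Finset.mem_range]
      exact ⟨hlow k, fun h => by by_contra hc; have := hhigh k (not_lt.1 hc); omega⟩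
  obtain ⟨r₂, hr₂, hs₂⟩ := exists_partialSum_eq hπ u (R := R) (m := N n + N (n + 1))
    (A := Finset.range (N n) ∪ F (N n)) (by omega) fun k => by
      rw [Finset.mem_union, Finset.mem_range]
      constructor
      · rintro (h | h)
        · have := hlow k h; omega
        · have hk := hl k n (hF _ k h) (hFlt n k h)
          rw [gpos k (by rwa [hk]), hk]
          have := hFlt n k h; omega
      · intro h
        by_contra! hc
        by_cases hk : l k = n
        · rw [gneg k (by rw [hk]; exact hc.2), hk] at h; omega
        · have : n < l k := by have := (hlt k).not.2 (not_lt.2 hc.1); omega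
          have h1 : N (n + 1) ≤ N (l k) := hNmono.monotone this
          have := glow k; omega
  rw [Finset.sum_union (Finset.disjoint_left.2 fun k h1 h2 =>
    absurd (hF _ k h2) (not_le.2 (Finset.mem_range.1 h1))), ← hs₁] at hs₂
  have e : ∑ k ∈ F (N n), u k = (∑ j ∈ Finset.range r₂, u (π j) - y)
      - (∑ j ∈ Finset.range r₁, u (π j) - y) := by rw [hs₂]; abel
  have := hFε (N n)
  rw [e] at this
  have := map_sub_le_add p (∑ j ∈ Finset.range r₂, u (π j) - y)
    (∑ j ∈ Finset.range r₁, u (π j) - y)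
  linarith [hR r₁ hr₁, hR r₂ hr₂]

end Rearrangement

/-! ### Coordinate functionals and finite sections -/

section Coordinates

variable {E : Type*} [AddCommGroup E] [Module ℝ E] [TopologicalSpace E]
  {e : ℕ → E} (he : IsSchauderBasis e)

theorem coord_add [IsTopologicalAddGroup E] (x y : E) :
    coord he (x + y) = coord he x + coord he y := by
  refine (coord_unique he ?_).symm
  have := (coord_spec he x).add (coord_spec he y)
  simpa [SeriesConverges, add_smul, Finset.sum_add_distrib] using this

theorem coord_smul [ContinuousConstSMul ℝ E] (c : ℝ) (x : E) :
    coord he (c • x) = c • coord he x := by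
  refine (coord_unique he ?_).symm
  have := (coord_spec he x).const_smul c
  simpa [SeriesConverges, mul_smul, Finset.smul_sum] using this

theorem coord_injective [T2Space E] : Function.Injective (coord he) := fun x y h =>
  tendsto_nhds_unique (coord_spec he x) (h ▸ coord_spec he y)

theorem coord_finsetSum (F : Finset ℕ) (c : ℕ → ℝ) :
    coord he (∑ k ∈ F, c k • e k) = fun k => if k ∈ F then c k else 0 := by
  refine (coord_unique he ?_).symm
  refine tendsto_const_nhds.congr' ?_
  filter_upwards [eventually_ge_atTop (F.sup id + 1)] with n hn
  simp only [ite_smul, zero_smul, Finset.sum_ite, Finset.sum_const_zero, add_zero]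
  refine Finset.sum_congr ?_ fun _ _ => rfl
  ext k
  simp only [Finset.mem_filter, Finset.mem_range, iff_and_self]
  intro hk
  have : k ≤ F.sup id := Finset.le_sup (f := id) hk
  omega

variable [IsTopologicalAddGroup E] [ContinuousConstSMul ℝ E]

/-- The `k`-th coordinate as a linear functional. -/
noncomputable def coordLinear (k : ℕ) : E →ₗ[ℝ] ℝ where
  toFun x := coord he x k
  map_add' x y := by simp [coord_add]
  map_smul' c x := by simp [coord_smul]

@[simp]
theorem coordLinear_apply (k : ℕ) (x : E) :
    coordLinear he k x = coord he x k := rfl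

theorem coord_sub (x y : E) :
    coord he (x - y) = coord he x - coord he y :=
  funext fun k => map_sub (coordLinear he k) x y

theorem coord_neg (x : E) : coord he (-x) = -coord he x :=
  funext fun k => map_neg (coordLinear he k) x

theorem IsSchauderBasis.basis_ne_zero (he : IsSchauderBasis e) (k : ℕ) : e k ≠ 0 := fun h => by
  have h1 := congrFun (coord_finsetSum he {k} fun _ => 1) k
  have h2 : coord he (0 : E) k = 0 := map_zero (coordLinear he k)
  simp [h, h2] at h1

/-- The projection onto the span of the basis vectors with index in `F`. -/
noncomputable def basisProj (F : Finset ℕ) : E →ₗ[ℝ] E :=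
  ∑ k ∈ F, (coordLinear he k).smulRight (e k)

theorem basisProj_apply (F : Finset ℕ) (x : E) :
    basisProj he F x = ∑ k ∈ F, coord he x k • e k := by
  simp [basisProj]

theorem basisProj_basisProj (F G : Finset ℕ) (x : E) :
    basisProj he F (basisProj he G x) = basisProj he (F ∩ G) x := by
  rw [basisProj_apply, basisProj_apply he G, coord_finsetSum, basisProj_apply]
  simp [ite_smul]

theorem basisProj_sub_basisProj (F G : Finset ℕ) (x : E) :
    basisProj he F (x - basisProj he G x) = basisProj he (F \ G) x := by
  rw [map_sub, basisProj_basisProj, sub_eq_iff_eq_add]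
  simp only [basisProj_apply]
  rw [add_comm, Finset.sum_inter_add_sum_sdiff]

theorem tendsto_basisProj_range (x : E) :
    Tendsto (fun n => basisProj he (Finset.range n) x) atTop (𝓝 x) := by
  simp only [basisProj_apply]
  exact coord_spec he x

end Coordinates

/-- Hahn–Banach extension from the line through `z`. This norming functional reduces later seminorm
estimates to scalar ones. -/
theorem Seminorm.exists_linear_eq {E : Type*} [AddCommGroup E] [Module ℝ E] (p : Seminorm ℝ E)
    (z : E) : ∃ φ : E →ₗ[ℝ] ℝ, φ z = p z ∧ ∀ x, |φ x| ≤ p x := by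
  by_cases hz : z = 0
  · exact ⟨0, by simp [hz], fun x => by simp⟩
  obtain ⟨φ, h1, h2⟩ := Module.Dual.exists_extension_of_le_seminorm_real _
    (LinearPMap.mkSpanSingleton (K := ℝ) z (p z) hz).toFun (p := p) (by
      rintro ⟨x, hx⟩
      obtain ⟨c, rfl⟩ := Submodule.mem_span_singleton.1 hx
      have : (LinearPMap.mkSpanSingleton (K := ℝ) z (p z) hz) ⟨c • z, hx⟩ = c • p z :=
        LinearPMap.mkSpanSingleton'_apply _ _ _ _ _
      refine this.le.trans ?_
      rw [map_smul_eq_mul, smul_eq_mul, Real.norm_eq_abs]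
      exact mul_le_mul_of_nonneg_right (le_abs_self c) (apply_nonneg p z))
  refine ⟨φ, ?_, h2⟩
  have := h1 ⟨z, Submodule.mem_span_singleton_self z⟩
  exact this.trans (LinearPMap.mkSpanSingleton_apply ℝ ℝ hz (p z))

/-! ### The section seminorm of an unconditional basis -/

section UnconditionalSeminorm

variable {E : Type*} [AddCommGroup E] [Module ℝ E] [TopologicalSpace E]
  [IsTopologicalAddGroup E] [ContinuousConstSMul ℝ E] {e : ℕ → E} (he : IsSchauderBasis e)

/-- The supremum of `p` over all finite sections of the basis expansion. -/
noncomputable def sectionSeminorm (p : Seminorm ℝ E) : Seminorm ℝ E :=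
  ⨆ F : Finset ℕ, p.comp (basisProj he F)

variable {he} {p : Seminorm ℝ E}

theorem exists_tail_lt (hunc : IsUnconditional he) (hp : Continuous p) (x : E) {ε : ℝ}
    (hε : 0 < ε) :
    ∃ N : ℕ, ∀ F : Finset ℕ, (∀ k ∈ F, N ≤ k) → p (basisProj he F x) < ε := by
  simp only [basisProj_apply]
  exact exists_tail_lt_of_forall_perm hp (fun k => coord he x k • e k) (hunc x) hε

/-- Makes the supremum in `sectionSeminorm` a genuine one: beyond some `N` every section has
seminorm below 1, and only finitely many terms remain. -/
theorem bddAbove_sections (hunc : IsUnconditional he) (hp : Continuous p) :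
    BddAbove (range fun F : Finset ℕ => p.comp (basisProj he F)) := by
  rw [Seminorm.bddAbove_range_iff]
  intro x
  obtain ⟨N, hN⟩ := exists_tail_lt hunc hp x one_pos
  refine ⟨1 + ∑ k ∈ Finset.range N, p (coord he x k • e k), ?_⟩
  rintro _ ⟨F, rfl⟩
  have h1 : basisProj he F x = basisProj he (F \ Finset.range N) x
      + basisProj he (F ∩ Finset.range N) x := by
    simp only [basisProj_apply]
    rw [add_comm, Finset.sum_inter_add_sum_sdiff]
  have h2 : p (basisProj he (F ∩ Finset.range N) x)
      ≤ ∑ k ∈ Finset.range N, p (coord he x k • e k) := by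
    rw [basisProj_apply]
    exact (Finset.le_sum_of_subadditive p (map_zero p).le (map_add_le_add p) _ _).trans
      (Finset.sum_le_sum_of_subset_of_nonneg
      Finset.inter_subset_right fun _ _ _ => apply_nonneg p _)
  have h3 := hN (F \ Finset.range N) fun k hk => by simpa using (Finset.mem_sdiff.1 hk).2
  have h4 := map_add_le_add p (basisProj he (F \ Finset.range N) x)
    (basisProj he (F ∩ Finset.range N) x)
  rw [← h1] at h4
  simp only [Seminorm.comp_apply]
  linarith

theorem le_sectionSeminorm (hunc : IsUnconditional he) (hp : Continuous p) (F : Finset ℕ)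
    (x : E) : p (basisProj he F x) ≤ sectionSeminorm he p x :=
  le_ciSup (bddAbove_sections hunc hp) F x

theorem sectionSeminorm_le (hunc : IsUnconditional he) (hp : Continuous p) {x : E} {b : ℝ}
    (h : ∀ F, p (basisProj he F x) ≤ b) : sectionSeminorm he p x ≤ b := by
  rw [sectionSeminorm, Seminorm.iSup_apply (bddAbove_sections hunc hp)]
  exact ciSup_le h

theorem seminorm_le_sectionSeminorm (hunc : IsUnconditional he) (hp : Continuous p) (x : E) :
    p x ≤ sectionSeminorm he p x :=
  le_of_tendsto ((hp.tendsto x).comp (tendsto_basisProj_range he x))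
    (Eventually.of_forall fun _ => le_sectionSeminorm hunc hp _ x)

theorem sectionSeminorm_sub_basisProj_le (hunc : IsUnconditional he) (hp : Continuous p)
    (G : Finset ℕ) (x : E) :
    sectionSeminorm he p (x - basisProj he G x) ≤ sectionSeminorm he p x :=
  sectionSeminorm_le hunc hp fun F => by
    rw [basisProj_sub_basisProj]; exact le_sectionSeminorm hunc hp _ x

theorem exists_sectionSeminorm_tail_le (hunc : IsUnconditional he) (hp : Continuous p) (x : E)
    {ε : ℝ} (hε : 0 < ε) :
    ∃ N : ℕ, ∀ n ≥ N, sectionSeminorm he p (x - basisProj he (Finset.range n) x) ≤ ε := by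
  obtain ⟨N, hN⟩ := exists_tail_lt hunc hp x hε
  refine ⟨N, fun n hn => sectionSeminorm_le hunc hp fun F => ?_⟩
  rw [basisProj_sub_basisProj]
  refine (hN _ fun k hk => ?_).le
  have := (Finset.mem_sdiff.1 hk).2
  rw [Finset.mem_range] at this
  omega

/-- Sums with coefficients dominated by those of `x` are controlled by the section seminorm. -/
theorem seminorm_sum_le_of_abs_le (hunc : IsUnconditional he) (hp : Continuous p) (x : E)
    {F : Finset ℕ} {c : ℕ → ℝ} (hc : ∀ k ∈ F, |c k| ≤ |coord he x k|) :
    p (∑ k ∈ F, c k • e k) ≤ 2 * sectionSeminorm he p x := by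
  classical
  obtain ⟨φ, h1, h2⟩ := Seminorm.exists_linear_eq p (∑ k ∈ F, c k • e k)
  -- The sums over the terms of positive and of negative sign are each sections of `x`, whence the
  -- factor 2.
  have key : ∀ G : Finset ℕ, |∑ k ∈ G, coord he x k * φ (e k)| ≤ sectionSeminorm he p x :=
    fun G => by
      have : ∑ k ∈ G, coord he x k * φ (e k) = φ (basisProj he G x) := by
        simp [basisProj_apply, map_sum]
      rw [this]
      exact (h2 _).trans (le_sectionSeminorm hunc hp G x)
  rw [← h1, map_sum]
  calc ∑ k ∈ F, φ (c k • e k) ≤ ∑ k ∈ F, |coord he x k * φ (e k)| := by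
        refine Finset.sum_le_sum fun k hk => ?_
        rw [map_smul, smul_eq_mul]
        refine (le_abs_self _).trans ?_
        rw [abs_mul, abs_mul]
        exact mul_le_mul_of_nonneg_right (hc k hk) (abs_nonneg _)
    _ = ∑ k ∈ F with 0 ≤ coord he x k * φ (e k), coord he x k * φ (e k)
        + -∑ k ∈ F with ¬ 0 ≤ coord he x k * φ (e k), coord he x k * φ (e k) := by
        rw [← Finset.sum_filter_add_sum_filter_not F (fun k => 0 ≤ coord he x k * φ (e k)),
          ← Finset.sum_neg_distrib]
        congr 1
        · exact Finset.sum_congr rfl fun k hk => abs_of_nonneg (Finset.mem_filter.1 hk).2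
        · exact Finset.sum_congr rfl fun k hk =>
            abs_of_neg (not_le.1 (Finset.mem_filter.1 hk).2)
    _ ≤ sectionSeminorm he p x + sectionSeminorm he p x :=
        add_le_add ((le_abs_self _).trans (key _)) ((neg_le_abs _).trans (key _))
    _ = 2 * sectionSeminorm he p x := by ring

end UnconditionalSeminorm

/-! ### Baire category and continuity of the section seminorms -/

open scoped Pointwise in
-- By Baire, one of the closed sets `closure (q.closedBall 0 n)` covering `E` has interior.
-- Differences move the interior point to the origin and scaling adjusts the radius, so `q` need not
-- be continuous.
theorem Seminorm.closure_closedBall_mem_nhds {E : Type*} [AddCommGroup E] [Module ℝ E]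
    [TopologicalSpace E] [IsTopologicalAddGroup E] [ContinuousConstSMul ℝ E] [BaireSpace E]
    (q : Seminorm ℝ E) {r : ℝ} (hr : 0 < r) : closure (q.closedBall 0 r) ∈ 𝓝 (0 : E) := by
  have hU : ⋃ n : ℕ, closure (q.closedBall 0 n) = univ := eq_univ_of_forall fun x =>
    mem_iUnion.2 ((exists_nat_ge (q x)).imp fun n hn => subset_closure (by simpa using hn))
  obtain ⟨n, x, hx⟩ := nonempty_interior_of_iUnion_of_closed (fun _ => isClosed_closure) hU
  have hn : (0 : ℝ) < n + 1 := by positivity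
  have h2 : closure (q.closedBall 0 (2 * (n + 1))) ∈ 𝓝 (0 : E) := by
    have hmap : Tendsto (fun u => x + u) (𝓝 0) (𝓝 x) := by
      simpa using (tendsto_id (x := 𝓝 (0 : E))).const_add x
    filter_upwards [hmap (mem_interior_iff_mem_nhds.1 hx)] with u hu
    have key : u = x + u - x := by abel
    rw [key]
    refine map_mem_closure₂ continuous_sub hu (interior_subset hx) fun a ha b hb => ?_
    simp only [Seminorm.mem_closedBall, sub_zero] at ha hb ⊢
    linarith [map_sub_le_add q a b]
  have hc : r / (2 * (n + 1)) ≠ 0 := (by positivity : 0 < r / (2 * ((n : ℝ) + 1))).ne'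
  refine mem_of_superset ((set_smul_mem_nhds_zero_iff hc).2 h2) ?_
  rintro _ ⟨u, hu, rfl⟩
  refine map_mem_closure (continuous_const_smul _) hu fun a ha => ?_
  simp only [Seminorm.mem_closedBall, sub_zero, map_smul_eq_mul, Real.norm_eq_abs] at ha ⊢
  rw [abs_of_pos (by positivity), div_mul_eq_mul_div, div_le_iff₀ (by positivity)]
  exact mul_le_mul_of_nonneg_left ha hr.le

section Continuity

variable {E : Type*} [AddCommGroup E] [Module ℝ E] [TopologicalSpace E]
  [IsTopologicalAddGroup E] [ContinuousConstSMul ℝ E] [T2Space E]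
  {e : ℕ → E} {he : IsSchauderBasis e} {p : ℕ → Seminorm ℝ E}

/-- A convergent sequence that is Cauchy for all section seminorms converges for them. -/
theorem exists_sectionSeminorm_sub_le (hp : WithSeminorms p) (hunc : IsUnconditional he)
    {s : ℕ → E} {x : E} (hs : Tendsto s atTop (𝓝 x))
    (hc : ∀ i, ∀ ε > 0, ∃ N, ∀ m ≥ N, ∀ n ≥ N, sectionSeminorm he (p i) (s n - s m) ≤ ε)
    (i : ℕ) {ε : ℝ} (hε : 0 < ε) :
    ∃ N, ∀ n ≥ N, sectionSeminorm he (p i) (s n - x) ≤ ε := by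
  have hcont := hp.continuous_seminorm
  -- A seminorm not vanishing on `e k` lets its one-term section control the `k`-th coordinate.
  have hcoord : ∀ k, ∃ c, Tendsto (fun n => coord he (s n) k) atTop (𝓝 c) := fun k => by
    obtain ⟨j, hj⟩ := hp.separating_of_T1 (e k) (he.basis_ne_zero k)
    have hj : 0 < p j (e k) := lt_of_le_of_ne (apply_nonneg _ _) (Ne.symm hj)
    refine cauchySeq_tendsto_of_complete (Metric.cauchySeq_iff.2 fun δ hδ => ?_)
    obtain ⟨N, hN⟩ := hc j (δ / 2 * p j (e k)) (by positivity)
    refine ⟨N, fun m hm n hn => ?_⟩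
    have h1 := (le_sectionSeminorm hunc (hcont j) {k} (s m - s n)).trans (hN n hn m hm)
    rw [basisProj_apply, Finset.sum_singleton, map_smul_eq_mul, coord_sub] at h1
    have h2 := le_of_mul_le_mul_right h1 hj
    rw [Real.dist_eq]
    simp only [Pi.sub_apply, Real.norm_eq_abs] at h2
    linarith
  choose c hc' using hcoord
  have hbound : ∀ j, ∀ δ > 0, ∃ N, ∀ n ≥ N, ∀ F : Finset ℕ,
      p j (∑ k ∈ F, (coord he (s n) k - c k) • e k) ≤ δ := fun j δ hδ => by
    obtain ⟨N, hN⟩ := hc j δ hδ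
    refine ⟨N, fun n hn F => ?_⟩
    have hlim : Tendsto (fun m => basisProj he F (s n - s m)) atTop
        (𝓝 (∑ k ∈ F, (coord he (s n) k - c k) • e k)) := by
      have := hp.continuousSMul
      simp only [basisProj_apply, coord_sub, Pi.sub_apply]
      exact tendsto_finsetSum _ fun k _ => ((hc' k).const_sub _).smul_const _
    refine le_of_tendsto (((hcont j).tendsto _).comp hlim) ?_
    filter_upwards [eventually_ge_atTop N] with m hm
    exact (le_sectionSeminorm hunc (hcont j) F _).trans (hN m hm n hn)
  -- Coordinate functionals are not yet known to be continuous, so the limits `c` are identified by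
  -- uniqueness: the series with coefficients `c` converges to `x`.
  have hx : c = coord he x := coord_unique he ((hp.tendsto_nhds_atTop _ _).2 fun j δ hδ => by
    obtain ⟨N, hN⟩ := hbound j (δ / 4) (by positivity)
    obtain ⟨N', hN'⟩ := (hp.tendsto_nhds_atTop _ _).1 hs j (δ / 4) (by positivity)
    set n := max N N'
    obtain ⟨M, hM⟩ := (hp.tendsto_nhds_atTop _ _).1 (tendsto_basisProj_range he (s n)) j (δ / 4)
      (by positivity)
    refine ⟨M, fun m hm => ?_⟩
    have hdec : ∑ k ∈ Finset.range m, c k • e k - x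
        = ((basisProj he (Finset.range m) (s n) - s n) + (s n - x))
          - ∑ k ∈ Finset.range m, (coord he (s n) k - c k) • e k := by
      simp only [sub_smul, Finset.sum_sub_distrib, basisProj_apply]
      abel
    rw [hdec]
    have h1 := hN n (le_max_left _ _) (Finset.range m)
    have h2 := hN' n (le_max_right _ _)
    have h3 := hM m hm
    have h4 := map_sub_le_add (p j)
      ((basisProj he (Finset.range m) (s n) - s n) + (s n - x))
      (∑ k ∈ Finset.range m, (coord he (s n) k - c k) • e k)
    have h5 := map_add_le_add (p j) (basisProj he (Finset.range m) (s n) - s n) (s n - x)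
    linarith)
  obtain ⟨N, hN⟩ := hbound i ε hε
  refine ⟨N, fun n hn => sectionSeminorm_le hunc (hcont i) fun F => ?_⟩
  rw [basisProj_apply, coord_sub, ← hx]
  exact hN n hn F

/-- The section seminorms of an unconditional basis of a Fréchet space are continuous. -/
theorem continuous_sectionSeminorm [BaireSpace E] (hp : WithSeminorms p)
    (hunc : IsUnconditional he) (i : ℕ) : Continuous (sectionSeminorm he (p i)) := by
  have hcont := hp.continuous_seminorm
  set q : ℕ → Seminorm ℝ E := fun j => sectionSeminorm he (p j)
  -- Increasing maxima, so that stage `n` of the approximation controls all indices up to `i + n`.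
  let Q : ℕ → Seminorm ℝ E := fun m => (Finset.range (m + 1)).sup q
  have hQ : ∀ m, ∀ j ≤ m, ∀ x, q j x ≤ Q m x := fun m j hj x =>
    Seminorm.le_finset_sup_apply (Finset.mem_range.2 (by omega))
  let ρ : ℕ → ℝ := fun n => (1 / 2) ^ n
  have hρ : ∀ n, 0 < ρ n := fun n => by positivity
  have hρ1 : ∀ n, ρ (n + 1) = ρ n / 2 := fun n => by simp only [ρ, pow_succ]; ring
  have hρlim : Tendsto ρ atTop (𝓝 0) :=
    tendsto_pow_atTop_nhds_zero_of_lt_one (by norm_num) (by norm_num)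
  let K : ℕ → Set E := fun n => closure ((Q (i + n)).closedBall 0 (ρ n))
  have hK : ∀ n, K n ∈ 𝓝 (0 : E) := fun n => Seminorm.closure_closedBall_mem_nhds _ (hρ n)
  -- Approximate `y` by a point `a` of the ball itself with remainder `y - a` in the next
  -- neighbourhood `K (n + 1)`; iteration gives the remainders `R n`.
  have hstep : ∀ n, ∀ y ∈ K n, ∃ z ∈ K (n + 1), Q (i + n) (y - z) ≤ ρ n := fun n y hy => by
    have h1 : Tendsto (fun a => y - a) (𝓝 y) (𝓝 0) := by
      simpa using (tendsto_id (x := 𝓝 y)).const_sub y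
    obtain ⟨a, ha1, ha2⟩ := mem_closure_iff_nhds.1 hy _ (h1 (hK (n + 1)))
    exact ⟨y - a, ha1, by simpa using ha2⟩
  choose! succR hsucc hsuccQ using hstep
  -- The radius is `2 * ρ 0 = 2` from the telescoped corrections plus 1 from the final
  -- approximation.
  refine Seminorm.continuous' (r := 3) (mem_of_superset (hK 0) fun x hx => ?_)
  rw [Seminorm.mem_closedBall, sub_zero]
  let R : ℕ → E := fun n => Nat.rec x (fun m y => succR m y) n
  have hR0 : R 0 = x := rfl
  have hR1 : ∀ n, R (n + 1) = succR n (R n) := fun _ => rfl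
  have hRK : ∀ n, R n ∈ K n := fun n => by
    induction n with
    | zero => exact hx
    | succ n ih => rw [hR1]; exact hsucc n _ ih
  -- Only the original seminorms, being continuous, pass to the closure defining `K n`; this
  -- suffices for `R n → 0` in `E`.
  have hRp : ∀ n, ∀ j ≤ i + n, p j (R n) ≤ ρ n := fun n j hj => by
    refine closure_minimal (fun a ha => ?_) (isClosed_le (hcont j) continuous_const) (hRK n)
    rw [Seminorm.mem_closedBall, sub_zero] at ha
    exact ((seminorm_le_sectionSeminorm hunc (hcont j) a).trans (hQ _ j hj a)).trans ha
  have hRq : ∀ n, ∀ j ≤ i + n, ∀ d, q j (R n - R (n + d)) ≤ 2 * ρ n - 2 * ρ (n + d) :=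
    fun n j hj d => by
      induction d with
      | zero => simp
      | succ d ih =>
        have h1 := (hQ (i + (n + d)) j (by omega) _).trans (hsuccQ (n + d) _ (hRK (n + d)))
        rw [← hR1] at h1
        have h2 := map_add_le_add (q j) (R n - R (n + d)) (R (n + d) - R (n + d + 1))
        rw [sub_add_sub_cancel] at h2
        rw [← add_assoc, hρ1]
        linarith
  have hRq' : ∀ n, ∀ j ≤ i + n, ∀ m ≥ n, q j (R n - R m) ≤ 2 * ρ n := fun n j hj m hm => by
    obtain ⟨d, rfl⟩ := Nat.exists_eq_add_of_le hm
    linarith [hRq n j hj d, hρ (n + d)]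
  have hRlim : Tendsto R atTop (𝓝 0) := (hp.tendsto_nhds_atTop _ _).2 fun j δ hδ => by
    obtain ⟨N, hN⟩ := eventually_atTop.1 (hρlim.eventually_lt_const hδ)
    refine ⟨max N j, fun n hn => ?_⟩
    rw [sub_zero]
    exact (hRp n j (by have := le_of_max_le_right hn; omega)).trans_lt
      (hN n (le_of_max_le_left hn))
  have hlim : Tendsto (fun n => x - R n) atTop (𝓝 x) := by simpa using hRlim.const_sub x
  obtain ⟨N, hN⟩ := exists_sectionSeminorm_sub_le hp hunc hlim (fun j δ hδ => by
    obtain ⟨N, hN⟩ := eventually_atTop.1 (hρlim.eventually_lt_const (by positivity : 0 < δ / 4))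
    refine ⟨max N j, fun m hm n hn => ?_⟩
    have hN' := hN (max N j) (le_max_left _ _)
    have h1 := hRq' (max N j) j (by have := le_max_right N j; omega) m hm
    have h2 := hRq' (max N j) j (by have := le_max_right N j; omega) n hn
    have h3 := map_sub_le_add (q j) (R (max N j) - R n) (R (max N j) - R m)
    have h4 : x - R n - (x - R m) = (R (max N j) - R n) - (R (max N j) - R m) := by abel
    rw [h4]
    change q j _ ≤ δ
    linarith) i one_pos
  have h1 := hN N le_rfl
  have h2 := hRq' 0 i (by omega) N (Nat.zero_le _)
  have h3 := map_sub_le_add (q i) (R 0 - R N) (x - R N - x)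
  have h4 : R 0 - R N - (x - R N - x) = x := by rw [hR0]; abel
  rw [h4] at h3
  have h5 : ρ 0 = 1 := pow_zero _
  change q i _ ≤ 1 at h1
  change q i _ ≤ 3
  linarith

end Continuity

/-! ### Convergence and completeness on order intervals -/

section OrderIntervals

variable {E : Type*} [AddCommGroup E] [Module ℝ E] {e : ℕ → E} {p : ℕ → Seminorm ℝ E}

theorem continuous_coord [TopologicalSpace E] [IsTopologicalAddGroup E]
    [ContinuousConstSMul ℝ E] [T2Space E] [BaireSpace E] (he : IsSchauderBasis e)
    (hp : WithSeminorms p) (hunc : IsUnconditional he) (k : ℕ) :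
    Continuous fun x => coord he x k := by
  obtain ⟨j, hj⟩ := hp.separating_of_T1 (e k) (he.basis_ne_zero k)
  have hj : 0 < p j (e k) := lt_of_le_of_ne (apply_nonneg _ _) (Ne.symm hj)
  refine continuous_iff_continuousAt.2 fun x => tendsto_iff_norm_sub_tendsto_zero.2 ?_
  have hlim : Tendsto (fun y => sectionSeminorm he (p j) (y - x) / p j (e k)) (𝓝 x) (𝓝 0) := by
    have h1 : Tendsto (fun y : E => y - x) (𝓝 x) (𝓝 0) := by
      simpa using (tendsto_id (x := 𝓝 x)).sub_const x
    have h2 := ((continuous_sectionSeminorm hp hunc j).tendsto 0).comp h1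
    simpa [Function.comp_def] using h2.div_const (p j (e k))
  refine squeeze_zero (fun _ => norm_nonneg _) (fun y => ?_) hlim
  rw [le_div_iff₀ hj]
  have h := le_sectionSeminorm hunc (hp.continuous_seminorm j) {k} (y - x)
  rwa [basisProj_apply, Finset.sum_singleton, map_smul_eq_mul, coord_sub] at h

/-- On order intervals, coordinatewise convergence implies convergence. -/
theorem tendsto_of_majorized [TopologicalSpace E] [IsTopologicalAddGroup E]
    [ContinuousConstSMul ℝ E] [T2Space E] [BaireSpace E] {he : IsSchauderBasis e}
    (hp : WithSeminorms p) (hunc : IsUnconditional he) {ι : Type*} {l : Filter ι} {z y : ι → E}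
    {z₀ y₀ : E} (hy : Tendsto y l (𝓝 y₀)) (hz : ∀ᶠ i in l, Majorized he (z i) (y i))
    (hz₀ : Majorized he z₀ y₀)
    (hc : ∀ k, Tendsto (fun i => coord he (z i) k) l (𝓝 (coord he z₀ k))) :
    Tendsto z l (𝓝 z₀) := by
  refine (hp.tendsto_nhds _ _).2 fun i ε hε => ?_
  have hcont := hp.continuous_seminorm i
  have := hp.continuousSMul
  set q := sectionSeminorm he (p i)
  obtain ⟨N, hN⟩ := exists_sectionSeminorm_tail_le hunc hcont y₀ (by positivity : 0 < ε / 16)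
  set S := basisProj he (Finset.range N)
  have hN : q (y₀ - S y₀) ≤ ε / 16 := hN N le_rfl
  -- Tails of a majorized vector are controlled by tails of its majorant, leaving only finitely many
  -- coordinates to compare.
  have tail : ∀ a b, Majorized he a b → p i (a - S a) ≤ 2 * q (b - S b) := fun a b hab => by
    have hlim : Tendsto (fun n => basisProj he (Finset.range n) (a - S a)) atTop
        (𝓝 (a - S a)) := tendsto_basisProj_range he _
    refine le_of_tendsto ((hcont.tendsto _).comp hlim) (Eventually.of_forall fun n => ?_)
    simp only [Function.comp_apply, S]
    rw [basisProj_sub_basisProj, basisProj_apply]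
    refine seminorm_sum_le_of_abs_le hunc hcont _ fun k hk => ?_
    rw [basisProj_apply, coord_sub, coord_finsetSum]
    simp only [Pi.sub_apply, (Finset.mem_sdiff.1 hk).2, if_false, sub_zero]
    exact (hab k).trans (le_abs_self _)
  have hy' : Tendsto (fun j => q (y j - y₀)) l (𝓝 0) := by
    have h1 : Tendsto (fun j => y j - y₀) l (𝓝 0) := by simpa using hy.sub_const y₀
    simpa [Function.comp_def] using ((continuous_sectionSeminorm hp hunc i).tendsto 0).comp h1
  have hS : Tendsto (fun j => p i (S (z j) - S z₀)) l (𝓝 0) := by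
    have h1 : Tendsto (fun j => S (z j) - S z₀) l (𝓝 0) := by
      have : Tendsto (fun j => S (z j)) l (𝓝 (S z₀)) := by
        simp only [S, basisProj_apply]
        exact tendsto_finsetSum _ fun k _ => (hc k).smul_const _
      simpa using this.sub_const (S z₀)
    simpa [Function.comp_def] using (hcont.tendsto 0).comp h1
  filter_upwards [hz, hy'.eventually_lt_const (by positivity : 0 < ε / 16),
    hS.eventually_lt_const (by positivity : 0 < ε / 4)] with j h1 h2 h3
  have h4 := tail _ _ h1
  have h5 := tail _ _ hz₀
  -- Continuity of `q` makes the tails of the moving majorants uniformly small with one fixed cutoff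
  -- `N`.
  have h6 : q (y j - S (y j)) ≤ q (y j - y₀) + ε / 16 := by
    have : y j - S (y j) = (y j - y₀ - S (y j - y₀)) + (y₀ - S y₀) := by
      rw [map_sub]; abel
    rw [this]
    exact (map_add_le_add q _ _).trans
      (add_le_add (sectionSeminorm_sub_basisProj_le hunc hcont _ _) hN)
  have h7 : z j - z₀ = (z j - S (z j)) - (z₀ - S z₀) + (S (z j) - S z₀) := by abel
  rw [h7]
  have h8 := map_add_le_add (p i) (z j - S (z j) - (z₀ - S z₀)) (S (z j) - S z₀)
  have h9 := map_sub_le_add (p i) (z j - S (z j)) (z₀ - S z₀)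
  linarith

/-- Blocks of the series `∑ c k • e k` are dominated by tails of `y`, so its partial sums are
Cauchy. -/
theorem exists_coord_eq_of_abs_le [UniformSpace E] [IsUniformAddGroup E] [CompleteSpace E]
    {he : IsSchauderBasis e} (hp : WithSeminorms p) (hunc : IsUnconditional he) {y : E}
    {c : ℕ → ℝ} (hc : ∀ k, |c k| ≤ coord he y k) : ∃ z, coord he z = c := by
  have := hp.continuousSMul
  set u : ℕ → E := fun n => ∑ k ∈ Finset.range n, c k • e k
  have hu : CauchySeq u := by
    rw [cauchySeq_iff_tendsto, uniformity_eq_comap_nhds_zero, tendsto_comap_iff]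
    refine (hp.tendsto_nhds _ _).2 fun i ε hε => ?_
    have hcont := hp.continuous_seminorm i
    obtain ⟨N, hN⟩ := exists_sectionSeminorm_tail_le hunc hcont y (by positivity : 0 < ε / 8)
    have key : ∀ n ≥ N, p i (u n - u N) ≤ ε / 4 := fun n hn => by
      have : u n - u N = ∑ k ∈ Finset.range n \ Finset.range N, c k • e k :=
        (Finset.sum_sdiff_eq_sub (Finset.range_mono hn)).symm
      rw [this]
      refine (seminorm_sum_le_of_abs_le hunc hcont
        (y - basisProj he (Finset.range N) y) fun k hk => ?_).trans (by linarith [hN N le_rfl])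
      rw [basisProj_apply, coord_sub, coord_finsetSum]
      simp only [Pi.sub_apply, (Finset.mem_sdiff.1 hk).2, if_false, sub_zero]
      exact (hc k).trans (le_abs_self _)
    filter_upwards [eventually_ge_atTop (N, N)] with m hm
    simp only [Function.comp_apply, sub_zero, Prod.map]
    have h1 := key m.1 hm.1
    have h2 := key m.2 hm.2
    have h3 := map_sub_le_add (p i) (u m.2 - u N) (u m.1 - u N)
    rw [sub_sub_sub_cancel_right] at h3
    linarith
  obtain ⟨z, hz⟩ := cauchySeq_tendsto_of_complete hu
  exact ⟨z, (coord_unique he hz).symm⟩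

end OrderIntervals

/-! ### From coordinatewise derivatives to derivatives in the space -/

section MeanValue

variable {E : Type*} [AddCommGroup E] [Module ℝ E]

/-- A functional norming the increment reduces this to the scalar mean value inequality. -/
theorem seminorm_sum_sub_le_of_hasDerivWithinAt (p : Seminorm ℝ E) (e : ℕ → E) (F : Finset ℕ)
    {s : Set ℝ} (hs : Convex ℝ s) {c c' : ℕ → ℝ → ℝ}
    (hc : ∀ k ∈ F, ∀ t ∈ s, HasDerivWithinAt (c k) (c' k t) s t) {C : ℝ}
    (hC : ∀ t ∈ s, p (∑ k ∈ F, c' k t • e k) ≤ C) {a b : ℝ} (ha : a ∈ s) (hb : b ∈ s) :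
    p (∑ k ∈ F, (c k b - c k a) • e k) ≤ C * |b - a| := by
  obtain ⟨φ, h1, h2⟩ := Seminorm.exists_linear_eq p (∑ k ∈ F, (c k b - c k a) • e k)
  have hd : ∀ t ∈ s, HasDerivWithinAt (fun r => ∑ k ∈ F, c k r * φ (e k))
      (∑ k ∈ F, c' k t * φ (e k)) s t := fun t ht =>
    HasDerivWithinAt.fun_sum fun k hk => (hc k hk t ht).mul_const _
  have := hs.norm_image_sub_le_of_norm_hasDerivWithin_le hd (C := C) (fun t ht => by
    refine le_trans ?_ ((h2 _).trans (hC t ht))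
    simp [map_sum]) ha hb
  rw [← h1]
  refine (le_abs_self _).trans (le_of_eq_of_le ?_ this)
  simp [map_sum, sub_mul, Finset.sum_sub_distrib]

end MeanValue

section Differentiation

variable {E : Type*} [AddCommGroup E] [Module ℝ E] [TopologicalSpace E]
  [IsTopologicalAddGroup E] [ContinuousConstSMul ℝ E] [T2Space E] [BaireSpace E]
  {e : ℕ → E} {he : IsSchauderBasis e} {p : ℕ → Seminorm ℝ E}

/-- A curve whose coordinates have derivatives given by a continuous curve is differentiable. -/
theorem hasDerivOnInterval_of_coord (hp : WithSeminorms p) (hunc : IsUnconditional he)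
    {T : ℝ} {x v : ℝ → E} (hv : ContinuousOn v (Icc 0 T))
    (hx : ∀ k, ∀ t ∈ Icc 0 T,
      HasDerivWithinAt (fun s => coord he (x s) k) (coord he (v t) k) (Icc 0 T) t)
    {t : ℝ} (ht : t ∈ Icc 0 T) : HasDerivOnInterval p T x (v t) t := by
  intro i
  have hcont := hp.continuous_seminorm i
  set q := sectionSeminorm he (p i)
  refine Metric.tendsto_nhds.2 fun ε hε => ?_
  have hq : Tendsto (fun s => q (v s - v t)) (𝓝[Icc 0 T] t) (𝓝 0) := by
    have h1 : Tendsto (fun s => v s - v t) (𝓝[Icc 0 T] t) (𝓝 0) := by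
      simpa using (hv t ht).sub_const (v t)
    simpa [Function.comp_def] using ((continuous_sectionSeminorm hp hunc i).tendsto 0).comp h1
  obtain ⟨δ, hδ, hball⟩ := Metric.mem_nhdsWithin_iff.1
    (hq.eventually_lt_const (half_pos hε))
  refine eventually_nhdsWithin_iff.2 (Metric.eventually_nhds_iff.2 ⟨δ, hδ, ?_⟩)
  rintro h hh ⟨h0, hth⟩
  have hconv : Convex ℝ (Metric.ball t δ ∩ Icc 0 T) := (convex_ball t δ).inter (convex_Icc 0 T)
  have hmem : t + h ∈ Metric.ball t δ ∩ Icc 0 T := ⟨by simpa using hh, hth⟩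
  have hmem' : t ∈ Metric.ball t δ ∩ Icc 0 T := ⟨Metric.mem_ball_self hδ, ht⟩
  have key : p i (x (t + h) - x t - h • v t) ≤ ε / 2 * |h| := by
    refine le_of_tendsto ((hcont.tendsto _).comp (tendsto_basisProj_range he _))
      (Eventually.of_forall fun n => ?_)
    -- Applied to sections of `x s - s • v t`, whose derivatives are sections of `v s - v t`; the
    -- section seminorm makes the bound independent of `n`.
    have hmv := seminorm_sum_sub_le_of_hasDerivWithinAt (p i) e (Finset.range n) hconv
      (c := fun k s => coord he (x s) k - s * coord he (v t) k)
      (c' := fun k s => coord he (v s) k - 1 * coord he (v t) k) (C := ε / 2)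
      (fun k _ s hs => ((hx k s hs.2).mono inter_subset_right).sub
        ((hasDerivWithinAt_id s _).mul_const _))
      (fun s hs => by
        have h1 := le_sectionSeminorm hunc hcont (Finset.range n) (v s - v t)
        simp only [basisProj_apply, coord_sub, Pi.sub_apply] at h1
        simp only [one_mul]
        exact h1.trans (le_of_lt (hball hs))) hmem' hmem
    rw [add_sub_cancel_left] at hmv
    refine le_of_eq_of_le ?_ hmv
    simp only [Function.comp_apply, basisProj_apply, coord_sub, coord_smul, Pi.sub_apply,
      Pi.smul_apply, smul_eq_mul]
    congr 1
    refine Finset.sum_congr rfl fun k _ => ?_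
    congr 1
    ring
  have h1 : h⁻¹ • (x (t + h) - x t) - v t = h⁻¹ • (x (t + h) - x t - h • v t) := by
    rw [smul_sub _ _ (h • v t), smul_smul, inv_mul_cancel₀ h0, one_smul]
  have hpos : 0 < |h| := abs_pos.2 h0
  rw [Real.dist_eq, sub_zero, abs_of_nonneg (apply_nonneg _ _), h1, map_smul_eq_mul, norm_inv,
    Real.norm_eq_abs]
  calc |h|⁻¹ * p i (x (t + h) - x t - h • v t) ≤ |h|⁻¹ * (ε / 2 * |h|) := by gcongr
    _ = ε / 2 := by field_simp
    _ < ε := half_lt_self hε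

end Differentiation

/-! ### Peano's theorem in a product of lines -/

section Peano

variable {ι : Type*}

/-- Approximate solutions of the integral equation, obtained by delaying the state by `δ`. -/
theorem exists_delayed_solution {F : ℝ → (ι → ℝ) → ι → ℝ}
    (hF : Continuous fun z : ℝ × (ι → ℝ) => F z.1 z.2) (a₀ : ι → ℝ) (T : ℝ) {δ : ℝ}
    (hδ : 0 < δ) :
    ∃ a : ℝ → ι → ℝ, Continuous a ∧ ∀ t ∈ Icc 0 T, ∀ k,
      a t k = a₀ k + ∫ s in (0 : ℝ)..t, F s (a (max (s - δ) 0)) k := by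
  let G : (ℝ → ι → ℝ) → ℝ → ι → ℝ := fun a t k =>
    a₀ k + ∫ s in (0 : ℝ)..t, F s (a (max (s - δ) 0)) k
  let b : ℕ → ℝ → ι → ℝ := fun n => Nat.rec (fun _ => a₀) (fun _ a => G a) n
  have hb : ∀ n, b (n + 1) = G (b n) := fun _ => rfl
  have hcont : ∀ n, Continuous (b n) := fun n => by
    induction n with
    | zero => exact continuous_const
    | succ n ih =>
      rw [hb]
      refine continuous_pi fun k => continuous_const.add ?_
      have hint : Continuous fun s => F s (b n (max (s - δ) 0)) k :=
        (continuous_apply k).comp (hF.comp (continuous_id.prodMk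
          (ih.comp ((continuous_id.sub continuous_const).max continuous_const))))
      exact intervalIntegral.continuous_primitive (fun _ _ => hint.intervalIntegrable _ _) 0
  -- The integrand looks back by `δ`, so each iteration settles the values on one more interval of
  -- length `δ`; finitely many iterations reach `T`.
  have hagree : ∀ n : ℕ, ∀ t, 0 ≤ t → t ≤ n * δ → b (n + 1) t = b n t := fun n => by
    induction n with
    | zero =>
      intro t h0 ht
      have : t = 0 := le_antisymm (by simpa using ht) h0
      subst this
      funext k
      change a₀ k + _ = a₀ k
      simp
    | succ n ih =>
      intro t h0 ht
      funext k
      rw [hb (n + 1)]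
      conv_rhs => rw [hb n]
      change a₀ k + _ = a₀ k + _
      congr 1
      refine intervalIntegral.integral_congr fun s hs => ?_
      rw [uIcc_of_le h0] at hs
      push_cast at ht
      have : b (n + 1) (max (s - δ) 0) = b n (max (s - δ) 0) := ih _ (le_max_right _ _)
        (max_le (by linarith [hs.2]) (by positivity))
      simp only [this]
  obtain ⟨n, hn⟩ := exists_nat_ge (T / δ)
  refine ⟨b n, hcont n, fun t ht k => ?_⟩
  have := hagree n t ht.1 (ht.2.trans ((div_le_iff₀ hδ).1 hn))
  exact (congrFun this k).symm

/-- Peano's theorem for (possibly infinite) systems of scalar equations, with right-hand sides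
that are bounded and continuous for the product topology. -/
theorem exists_solution_of_bounded_continuous {F : ℝ → (ι → ℝ) → ι → ℝ}
    (hF : Continuous fun z : ℝ × (ι → ℝ) => F z.1 z.2) {M : ι → ℝ}
    (hM : ∀ t a k, |F t a k| ≤ M k) (a₀ : ι → ℝ) {T : ℝ} (hT : 0 ≤ T) :
    ∃ a : ℝ → ι → ℝ, a 0 = a₀ ∧ ∀ t ∈ Icc 0 T, ∀ k,
      HasDerivWithinAt (fun s => a s k) (F t (a t) k) (Icc 0 T) t := by
  have hδpos : ∀ n : ℕ, (0 : ℝ) < 1 / ((n : ℝ) + 1) := fun n => by positivity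
  choose b hbc hb using fun n : ℕ => exists_delayed_solution hF a₀ T (hδpos n)
  have hb0 : ∀ n, b n 0 = a₀ := fun n => funext fun k => by
    rw [hb n 0 ⟨le_rfl, hT⟩ k]; simp
  have hint : ∀ n k, Continuous fun s => F s (b n (max (s - 1 / ((n : ℝ) + 1)) 0)) k :=
    fun n k => (continuous_apply k).comp (hF.comp (continuous_id.prodMk
      ((hbc n).comp ((continuous_id.sub continuous_const).max continuous_const))))
  have hsub : ∀ n, ∀ s ∈ Icc 0 T, ∀ t ∈ Icc 0 T, ∀ k, b n t k - b n s k
      = ∫ r in s..t, F r (b n (max (r - 1 / ((n : ℝ) + 1)) 0)) k := fun n s hs t ht k => by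
    rw [hb n s hs k, hb n t ht k, add_sub_add_left_eq_sub]
    exact intervalIntegral.integral_interval_sub_left ((hint n k).intervalIntegrable _ _)
      ((hint n k).intervalIntegrable _ _)
  have hlip : ∀ n, ∀ s ∈ Icc 0 T, ∀ t ∈ Icc 0 T, ∀ k, |b n t k - b n s k| ≤ M k * |t - s| :=
    fun n s hs t ht k => by
      rw [hsub n s hs t ht k]
      exact intervalIntegral.norm_integral_le_of_norm_le_const fun r _ =>
        (Real.norm_eq_abs _).le.trans (hM r _ k)
  -- Tychonoff compactness gives pointwise limits along an ultrafilter, so no subsequence is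
  -- extracted and `ι` may be arbitrary.
  let U : Ultrafilter ℕ := Ultrafilter.of atTop
  have hU : (U : Filter ℕ) ≤ atTop := Ultrafilter.of_le atTop
  have hlim : ∀ t ∈ Icc 0 T, ∃ a : ι → ℝ, Tendsto (fun n => b n t) U (𝓝 a) := fun t ht => by
    have hK : IsCompact (univ.pi fun k => Metric.closedBall (a₀ k) (M k * |t - 0|)) :=
      isCompact_univ_pi fun k => isCompact_closedBall _ _
    obtain ⟨a, -, ha⟩ := hK.ultrafilter_le_nhds (U.map fun n => b n t)
      (by
        refine le_principal_iff.2 (Eventually.of_forall (f := (U : Filter ℕ)) fun n k _ => ?_)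
        rw [Metric.mem_closedBall, Real.dist_eq, ← hb0 n]
        exact hlip n 0 ⟨le_rfl, hT⟩ t ht k)
    exact ⟨a, ha⟩
  choose! a ha using hlim
  refine ⟨a, ?_, fun t ht k => ?_⟩
  · refine tendsto_nhds_unique (ha 0 ⟨le_rfl, hT⟩) ?_
    simpa only [hb0] using tendsto_const_nhds
  -- The Lipschitz bound, uniform in `n`, absorbs both the moving time and the vanishing delay.
  have hjoint : Tendsto (fun z : ℝ × ℕ => b z.2 (max (z.1 - 1 / ((z.2 : ℝ) + 1)) 0))
      (𝓝[Icc 0 T] t ×ˢ (U : Filter ℕ)) (𝓝 (a t)) := by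
    refine tendsto_pi_nhds.2 fun j => ?_
    have h1 : Tendsto (fun z : ℝ × ℕ => b z.2 t j) (𝓝[Icc 0 T] t ×ˢ (U : Filter ℕ))
        (𝓝 (a t j)) := (tendsto_pi_nhds.1 (ha t ht) j).comp tendsto_snd
    have hs : Tendsto (fun z : ℝ × ℕ => max (z.1 - 1 / ((z.2 : ℝ) + 1)) 0)
        (𝓝[Icc 0 T] t ×ˢ (U : Filter ℕ)) (𝓝 t) := by
      have h2 : Tendsto (fun z : ℝ × ℕ => z.1) (𝓝[Icc 0 T] t ×ˢ (U : Filter ℕ)) (𝓝 t) :=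
        tendsto_fst.mono_right nhdsWithin_le_nhds
      have h3 : Tendsto (fun z : ℝ × ℕ => 1 / ((z.2 : ℝ) + 1))
          (𝓝[Icc 0 T] t ×ˢ (U : Filter ℕ)) (𝓝 0) :=
        (tendsto_one_div_add_atTop_nhds_zero_nat.mono_left hU).comp tendsto_snd
      simpa [max_eq_left ht.1] using (h2.sub h3).max (tendsto_const_nhds (x := (0 : ℝ)))
    have h2 : Tendsto (fun z : ℝ × ℕ =>
        b z.2 (max (z.1 - 1 / ((z.2 : ℝ) + 1)) 0) j - b z.2 t j)
        (𝓝[Icc 0 T] t ×ˢ (U : Filter ℕ)) (𝓝 0) := by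
      have h3 : Tendsto (fun z : ℝ × ℕ => M j * |max (z.1 - 1 / ((z.2 : ℝ) + 1)) 0 - t|)
          (𝓝[Icc 0 T] t ×ˢ (U : Filter ℕ)) (𝓝 0) := by
        simpa using ((hs.sub_const t).abs).const_mul (M j)
      refine squeeze_zero_norm' ?_ h3
      have : ∀ᶠ z : ℝ × ℕ in 𝓝[Icc 0 T] t ×ˢ (U : Filter ℕ), z.1 ∈ Icc 0 T :=
        tendsto_fst.eventually self_mem_nhdsWithin
      filter_upwards [this] with z hz
      have := hδpos z.2
      exact hlip z.2 t ht _ ⟨le_max_right _ _, max_le (by linarith [hz.2]) hT⟩ j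
    simpa using h2.add h1
  have hFlim : Tendsto (fun z : ℝ × ℕ => F z.1 (b z.2 (max (z.1 - 1 / ((z.2 : ℝ) + 1)) 0)) k)
      (𝓝[Icc 0 T] t ×ˢ (U : Filter ℕ)) (𝓝 (F t (a t) k)) :=
    (((continuous_apply k).comp hF).tendsto (t, a t)).comp
      ((tendsto_fst.mono_right nhdsWithin_le_nhds).prodMk_nhds hjoint)
  rw [hasDerivWithinAt_iff_isLittleO]
  refine Asymptotics.isLittleO_iff.2 fun ε hε => ?_
  -- The joint limit keeps the integrand within `ε` of `F t (a t) k` near `t` for `U`-almost all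
  -- `n`; only the integrated inequality is passed to the limit.
  obtain ⟨P, hP, Q, hQ, hPQ⟩ := eventually_prod_iff.1 (Metric.tendsto_nhds.1 hFlim ε hε)
  obtain ⟨η, hη, hball⟩ := Metric.mem_nhdsWithin_iff.1 hP
  filter_upwards [Metric.mem_nhdsWithin_iff.2 ⟨η, hη, Subset.rfl⟩] with s hs
  have hconv : Convex ℝ (Metric.ball t η ∩ Icc 0 T) := (convex_ball t η).inter (convex_Icc 0 T)
  have hlim : Tendsto (fun n => ‖b n s k - b n t k - (s - t) • F t (a t) k‖) U
      (𝓝 ‖a s k - a t k - (s - t) • F t (a t) k‖) :=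
    (((tendsto_pi_nhds.1 (ha s hs.2) k).sub (tendsto_pi_nhds.1 (ha t ht) k)).sub_const _).norm
  refine le_of_tendsto hlim ?_
  filter_upwards [hQ] with n hn
  have hi : b n s k - b n t k - (s - t) • F t (a t) k
      = ∫ r in t..s, (F r (b n (max (r - 1 / ((n : ℝ) + 1)) 0)) k - F t (a t) k) := by
    rw [intervalIntegral.integral_sub ((hint n k).intervalIntegrable _ _)
      intervalIntegrable_const, intervalIntegral.integral_const, hsub n t ht s hs.2 k]
  rw [hi, Real.norm_eq_abs (s - t)]
  refine intervalIntegral.norm_integral_le_of_norm_le_const fun r hr => ?_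
  have hr' : r ∈ Metric.ball t η ∩ Icc 0 T :=
    (hconv.ordConnected.uIcc_subset ⟨Metric.mem_ball_self hη, ht⟩ hs) (uIoc_subset_uIcc hr)
  exact (hPQ (hball hr') hn).le

end Peano

/-- The barrier `B + ε (1 + t)` makes the comparison strict: where `u` touches it, `u ≥ B`, so `u' ≤
B' < B' + ε`. Then `ε` tends to 0. -/
theorem le_of_hasDerivWithinAt_le_of_ge {T : ℝ} {u u' B B' : ℝ → ℝ}
    (hu : ∀ t ∈ Icc 0 T, HasDerivWithinAt u (u' t) (Icc 0 T) t)
    (hB : ∀ t ∈ Icc 0 T, HasDerivWithinAt B (B' t) (Icc 0 T) t) (h0 : u 0 ≤ B 0)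
    (h : ∀ t ∈ Icc 0 T, B t ≤ u t → u' t ≤ B' t) {t : ℝ} (ht : t ∈ Icc 0 T) : u t ≤ B t := by
  have hIci : ∀ {g g' : ℝ → ℝ}, (∀ t ∈ Icc 0 T, HasDerivWithinAt g (g' t) (Icc 0 T) t) →
      ∀ t ∈ Ico 0 T, HasDerivWithinAt g (g' t) (Ici t) t := fun hg t ht =>
    (hg t (Ico_subset_Icc_self ht)).mono_of_mem_nhdsWithin
      (mem_of_superset (Icc_mem_nhdsGE ht.2) (Icc_subset_Icc_left ht.1))
  have key : ∀ ε > 0, u t ≤ B t + ε * (1 + t) := fun ε hε => by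
    have hB2 : ∀ t ∈ Icc 0 T,
        HasDerivWithinAt (fun s => B s + ε * (1 + s)) (B' t + ε) (Icc 0 T) t := fun t ht => by
      simpa using (hB t ht).fun_add (((hasDerivWithinAt_id t _).const_add 1).const_mul ε)
    refine image_le_of_deriv_right_lt_deriv_boundary'
      (fun s hs => (hu s hs).continuousWithinAt) (hIci hu) ?_
      (fun s hs => (hB2 s hs).continuousWithinAt) (hIci hB2) (fun s hs heq => ?_) ht
    · linarith
    · have : 0 ≤ ε * (1 + s) := mul_nonneg hε.le (by linarith [hs.1])
      linarith [h s (Ico_subset_Icc_self hs) (by linarith)]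
  have hpos : 0 < 1 + t := by linarith [ht.1]
  refine le_of_forall_pos_le_add fun ε hε => ?_
  simpa [div_mul_cancel₀ _ hpos.ne'] using key (ε / (1 + t)) (by positivity)

end FrechetODE

/-! ### Truncation, comparison and conclusion -/

theorem theorem2p1
    {E : Type*} [AddCommGroup E] [Module ℝ E]
    -- `E` is a real Fréchet space with topology given by the seminorms `p 0, p 1, …`
    [UniformSpace E] [IsUniformAddGroup E] [T2Space E] [CompleteSpace E]
    (p : ℕ → Seminorm ℝ E) (hp : WithSeminorms p)
    (e : ℕ → E) (he : IsSchauderBasis e) (hunc : IsUnconditional he)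
    (T : ℝ) (hT : 0 < T)
    (X : ℝ → E) (hX : ContinuousOn X (Set.Icc 0 T))
    (hX1 : ∀ k, ContDiffOn ℝ 1 (fun t => coord he (X t) k) (Set.Icc 0 T))
    (hXpos : ∀ k, ∀ t ∈ Set.Icc 0 T, 0 < coord he (X t) k)
    (f : ℝ → E → E)
    (hf : ContinuousOn (fun z : ℝ × E => f z.1 z.2) (majorantSet he T X))
    (hmaj : ∀ t x, (t, x) ∈ majorantSet he T X → ∀ k,
      coord he (f t (replaceCoord he k (X t) x)) k
          ≤ derivWithin (fun s => coord he (X s) k) (Set.Icc 0 T) t ∧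
        -coord he (f t (replaceCoord he k (-X t) x)) k
          ≤ derivWithin (fun s => coord he (X s) k) (Set.Icc 0 T) t)
    (x₀ : E) (hx₀ : Majorized he x₀ (X 0)) :
    ∃ x : ℝ → E, IsC1OnInterval p T x ∧ x 0 = x₀ ∧
      (∀ t ∈ Set.Icc 0 T, HasDerivOnInterval p T x (f t (x t)) t) ∧
      ∀ t ∈ Set.Icc 0 T, Majorized he (x t) (X t) := by
  have := hp.continuousSMul
  -- Countably many seminorms give a countably generated uniformity; with completeness this yields
  -- the Baire property.
  have := hp.firstCountableTopology
  have : (uniformity E).IsCountablyGenerated := IsUniformAddGroup.uniformity_countably_generated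
  have : BaireSpace E := inferInstance
  have hcoord := continuous_coord he hp hunc
  -- Clamping time to `[0, T]` makes the truncated field globally defined and continuous.
  let τ : ℝ → ℝ := fun t => projIcc 0 T hT.le t
  have hτ : ∀ t, τ t ∈ Icc 0 T := fun t => (projIcc 0 T hT.le t).2
  have hτcont : Continuous τ := continuous_subtype_val.comp continuous_projIcc
  have hτid : ∀ t ∈ Icc 0 T, τ t = t := fun t ht => by simp [τ, projIcc_of_mem hT.le ht]
  have hY : Continuous fun t => X (τ t) := hX.comp_continuous hτcont hτ
  let cl : ℝ → (ℕ → ℝ) → ℕ → ℝ := fun t a k =>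
    max (-coord he (X (τ t)) k) (min (a k) (coord he (X (τ t)) k))
  have hcl : ∀ t a k, |cl t a k| ≤ coord he (X (τ t)) k := fun t a k =>
    abs_le.2 ⟨le_max_left _ _,
      max_le (by linarith [hXpos k _ (hτ t)]) (min_le_right _ _)⟩
  have hclid : ∀ t a k, |a k| ≤ coord he (X (τ t)) k → cl t a k = a k := fun t a k h => by
    simp only [cl]
    rw [min_eq_left (abs_le.1 h).2, max_eq_right (abs_le.1 h).1]
  have hex : ∀ t a, ∃ z, coord he z = cl t a := fun t a =>
    exists_coord_eq_of_abs_le hp hunc (hcl t a)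
  choose Ψ hΨ using hex
  have hΨmaj : ∀ t a, Majorized he (Ψ t a) (X (τ t)) := fun t a k => by
    rw [hΨ]; exact hcl t a k
  have hΨcont : Continuous fun z : ℝ × (ℕ → ℝ) => Ψ z.1 z.2 := by
    refine continuous_iff_continuousAt.2 fun z => ?_
    refine tendsto_of_majorized hp hunc (y := fun w : ℝ × (ℕ → ℝ) => X (τ w.1))
      ((hY.comp continuous_fst).tendsto' z (X (τ z.1)) rfl)
      (Eventually.of_forall fun w => hΨmaj w.1 w.2)
      (hΨmaj z.1 z.2) fun k => ?_
    simp only [hΨ]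
    have h1 : Continuous fun w : ℝ × (ℕ → ℝ) => coord he (X (τ w.1)) k :=
      (hcoord k).comp (hY.comp continuous_fst)
    exact (h1.neg.max (((continuous_apply k).comp continuous_snd).min h1)).tendsto z
  let F : ℝ → (ℕ → ℝ) → ℕ → ℝ := fun t a => coord he (f (τ t) (Ψ t a))
  have hFcont : Continuous fun z : ℝ × (ℕ → ℝ) => F z.1 z.2 := continuous_pi fun k =>
    (hcoord k).comp (hf.comp_continuous ((hτcont.comp continuous_fst).prodMk hΨcont)
      fun z => ⟨hτ z.1, hΨmaj z.1 z.2⟩)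
  -- The field depends only on the clamped time and truncated coordinates, which range in a compact
  -- product of intervals.
  have hbound : ∀ k, ∃ M, ∀ t a, |F t a k| ≤ M := fun k => by
    have hC : ∀ j, ∃ C, ∀ t ∈ Icc 0 T, ‖coord he (X (τ t)) j‖ ≤ C := fun j =>
      isCompact_Icc.exists_bound_of_continuousOn ((hcoord j).comp hY).continuousOn
    choose C hC using hC
    obtain ⟨M, hM⟩ := (isCompact_Icc.prod
      (isCompact_univ_pi fun j => isCompact_Icc)).exists_bound_of_continuousOn
      (s := Icc (0 : ℝ) T ×ˢ univ.pi fun j => Icc (-C j) (C j))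
      ((continuous_apply k).comp hFcont).continuousOn
    refine ⟨M, fun t a => ?_⟩
    have hττ : τ (τ t) = τ t := hτid _ (hτ t)
    have hmem : (τ t, cl t a) ∈ Icc (0 : ℝ) T ×ˢ univ.pi fun j => Icc (-C j) (C j) :=
      ⟨hτ t, fun j _ => abs_le.1 ((hcl t a j).trans
        ((le_abs_self _).trans (by simpa [hττ] using hC j (τ t) (hτ t))))⟩
    have heq : Ψ (τ t) (cl t a) = Ψ t a := coord_injective he (by
      rw [hΨ, hΨ]
      exact funext fun j => hclid _ _ j (by rw [hττ]; exact hcl t a j))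
    have := hM _ hmem
    simpa [F, hττ, heq] using this
  choose M hM using hbound
  obtain ⟨a, ha0, ha⟩ := exists_solution_of_bounded_continuous hFcont
    (fun t b k => hM k t b) (coord he x₀) hT.le
  have hXd : ∀ k, ∀ t ∈ Icc 0 T, HasDerivWithinAt (fun s => coord he (X s) k)
      (derivWithin (fun s => coord he (X s) k) (Icc 0 T) t) (Icc 0 T) t := fun k t ht =>
    ((hX1 k).differentiableOn one_ne_zero t ht).hasDerivWithinAt
  -- If truncation has already placed the `k`-th coordinate on a face, `replaceCoord` does nothing,
  -- so the hypothesis on `f` applies at `Ψ t (a t)` itself.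
  have hrep : ∀ t ∈ Icc 0 T, ∀ k y, coord he y k = cl t (a t) k →
      replaceCoord he k y (Ψ t (a t)) = Ψ t (a t) := fun t _ k y hy => coord_injective he (by
    rw [coord_replaceCoord, hΨ, hy, Function.update_eq_self])
  have hmem : ∀ t ∈ Icc 0 T, (t, Ψ t (a t)) ∈ majorantSet he T X := fun t ht =>
    ⟨ht, by simpa [hτid t ht] using hΨmaj t (a t)⟩
  have hle : ∀ k, ∀ t ∈ Icc 0 T, a t k ≤ coord he (X t) k := fun k t ht => by
    refine le_of_hasDerivWithinAt_le_of_ge (fun s hs => ha s hs k) (hXd k) ?_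
      (fun s hs hge => ?_) ht
    · rw [ha0]; exact (abs_le.1 (hx₀ k)).2
    · have h1 := (hmaj s _ (hmem s hs) k).1
      rw [hrep s hs k (X s) (by
        simp only [cl, hτid s hs]
        rw [min_eq_right hge, max_eq_right (by linarith [hXpos k s hs])])] at h1
      simpa [F, hτid s hs] using h1
  have hge : ∀ k, ∀ t ∈ Icc 0 T, -a t k ≤ coord he (X t) k := fun k t ht => by
    refine le_of_hasDerivWithinAt_le_of_ge (fun s hs => (ha s hs k).neg) (hXd k) ?_
      (fun s hs hge => ?_) ht
    · simp only [Pi.neg_apply, ha0]; linarith [(abs_le.1 (hx₀ k)).1]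
    · simp only [Pi.neg_apply] at hge
      have h1 := (hmaj s _ (hmem s hs) k).2
      rw [hrep s hs k (-X s) (by
        simp only [cl, hτid s hs, coord_neg, Pi.neg_apply]
        rw [max_eq_left]
        exact (min_le_left _ _).trans (by linarith))] at h1
      simpa [F, hτid s hs] using h1
  have hcoordΨ : ∀ t ∈ Icc 0 T, coord he (Ψ t (a t)) = a t := fun t ht => by
    rw [hΨ]
    exact funext fun k => hclid _ _ k (by
      rw [hτid t ht]; exact abs_le.2 ⟨by linarith [hge k t ht], hle k t ht⟩)
  have hacont : ContinuousOn a (Icc 0 T) := continuousOn_pi.2 fun k t ht =>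
    (ha t ht k).continuousWithinAt
  have hxcont : ContinuousOn (fun t => Ψ t (a t)) (Icc 0 T) :=
    hΨcont.comp_continuousOn (continuousOn_id.prodMk hacont)
  have hv : ContinuousOn (fun t => f t (Ψ t (a t))) (Icc 0 T) :=
    hf.comp (continuousOn_id.prodMk hxcont) hmem
  have hder : ∀ t ∈ Icc 0 T, HasDerivOnInterval p T (fun t => Ψ t (a t)) (f t (Ψ t (a t))) t :=
    fun t ht => hasDerivOnInterval_of_coord hp hunc hv (fun k s hs => by
      have h1 := ha s hs k
      simp only [F, hτid s hs] at h1
      exact h1.congr (fun r hr => congrFun (hcoordΨ r hr) k) (congrFun (hcoordΨ s hs) k)) ht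
  have h0 : (0 : ℝ) ∈ Icc 0 T := ⟨le_rfl, hT.le⟩
  exact ⟨fun t => Ψ t (a t), ⟨_, hder, hv⟩, coord_injective he ((hcoordΨ 0 h0).trans ha0), hder,
    fun t ht => (hmem t ht).2⟩
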